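/- Let $\langle A\mid R\rangle$ be a finite presentation of a group $G$ in which no generator $a\in A$ represents the identity. A van Kampen diagram $\Delta$ over $\langle A\mid R\rangle$ is a finite contractible 2-complex embedded in $\mathbb R^2$ with a base vertex $*$ on its topological boundary $\partial\Delta$ such that, for each 1-cell of $\Delta$, one of the two corresponding directed edges is labelled by some $a\in A$ and the other by $a^{-1}$, and there is a cellular map from $\Delta$ to the Cayley 2-complex of $\langle A\mid R\rangle$ that preserves the directions and labels of these edges. Let $T$ be a spanning tree of $\Delta$. For a 1-cell $e$ of $\Delta$ not in $T$, directed from a vertex $x$ to a vertex $y$, let $\gamma_x$ and $\gamma_y$ be the unique simple paths in $T$ from $*$ to $x$ and to $y$, let $\alpha$ be their longest common initial segment, and write $\gamma_x=\alpha\cdot\beta_x$ and $\gamma_y=\alpha\cdot\beta_y$. Then $\eta=\beta_x\cdot e\cdot\overline{\beta_y}$ is a simple circuit. The icicle $I_e\subseteq\mathbb R^2$ is the union of $\alpha$, $\eta$, and the inside of $\eta$ (the bounded component of $\mathbb R^2\setminus\eta$). Let $e,e'$ be 1-cells of $\Delta$ that are not in $T$. 1. If $e'\subseteq I_e$, then $I_{e'}\subseteq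 I_e$. 2. If $e'\not\subseteq I_e$ and $e\not\subseteq I_{e'}$, then $\operatorname{int}(I_e)\cap\operatorname{int}(I_{e'})=\emptyset$, where $\operatorname{int}$ denotes the interior in $\mathbb R^2$. -/

import Mathlib

/-!
Icicles of a spanning tree of a van Kampen diagram: presentations and their Cayley 2-complexes,
van Kampen diagrams as finite contractible CW 2-complexes in the plane, edge paths, spanning
trees, and icicles.
-/

open Topology

noncomputable section

/-- The Euclidean plane `ℝ²`. -/
abbrev Plane : Type := EuclideanSpace ℝ (Fin 2)

/-! ### Presentations and the Cayley 2-complex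

A letter `(a, true)` stands for the generator `a` and `(a, false)` for its formal inverse; a word
is a list of letters, and a presentation `⟨A | R⟩` is given by a set `R` of words over `A`. -/

/-- The group `⟨A | R⟩`. -/
abbrev GroupOf {A : Type*} (R : Set (List (A × Bool))) : Type _ :=
  PresentedGroup (FreeGroup.mk '' R)

/-- The element of `⟨A | R⟩` represented by a word. -/
def wordVal {A : Type*} (R : Set (List (A × Bool))) (w : List (A × Bool)) : GroupOf R :=
  PresentedGroup.mk (FreeGroup.mk '' R) (FreeGroup.mk w)

/-- The disjoint union of the closed cells of the Cayley 2-complex: a point for every `g`, an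
interval for every pair `(g, a)`, and a closed disc for every pair `(g, r)` with `r` a relator. -/
abbrev CayleyCells {A : Type*} (R : Set (List (A × Bool))) : Type _ :=
  (Σ _ : GroupOf R, Unit) ⊕
    ((Σ _ : GroupOf R × A, unitInterval) ⊕
      (Σ _ : GroupOf R × R, Metric.closedBall (0 : ℂ) 1))

namespace CayleyCells

variable {A : Type*} {R : Set (List (A × Bool))}

/-- The 0-cell at `g`. -/
def vert (g : GroupOf R) : CayleyCells R := Sum.inl ⟨g, ()⟩

/-- The point at time `s` of the 1-cell labelled `a` that starts at `g`. -/
def edge (g : GroupOf R) (a : A) (s : unitInterval) : CayleyCells R :=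
  Sum.inr (Sum.inl ⟨(g, a), s⟩)

/-- The point `z` of the 2-cell for the relator `r` based at `g`. -/
def disc (g : GroupOf R) (r : R) (z : Metric.closedBall (0 : ℂ) 1) : CayleyCells R :=
  Sum.inr (Sum.inr ⟨(g, r), z⟩)

/-- The point at time `s` of the directed edge labelled by the letter `x` that starts at `g`. The
edge labelled `a⁻¹` that starts at `g` is the reverse of the edge labelled `a` that starts at
`g * a⁻¹`. -/
def letterPt (g : GroupOf R) (x : A × Bool) (s : unitInterval) : CayleyCells R :=
  if x.2 then edge g x.1 s else edge (g * wordVal R [x]) x.1 (unitInterval.symm s)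

/-- The gluing relation: the interval `(g, a)` runs from `g` to `g * a`, and the boundary circle of
the disc `(g, r)` runs, letter by letter and at constant speed, along the edge path that starts at
`g` and is labelled by `r` (it is collapsed to `g` if `r` is the empty word). -/
inductive Glue : CayleyCells R → CayleyCells R → Prop
  | source (g : GroupOf R) (a : A) : Glue (edge g a 0) (vert g)
  | target (g : GroupOf R) (a : A) : Glue (edge g a 1) (vert (g * wordVal R [(a, true)]))
  | face (g : GroupOf R) (r : R) (i : ℕ) (hi : i < r.1.length) (s : unitInterval)
      (z : Metric.closedBall (0 : ℂ) 1)
      (hz : z.1 = Complex.exp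
        (2 * Real.pi * Complex.I * (((i : ℝ) + (s : ℝ)) / (r.1.length : ℝ) : ℝ))) :
      Glue (disc g r z) (letterPt (g * wordVal R (r.1.take i)) r.1[i] s)
  | emptyFace (g : GroupOf R) (r : R) (hr : r.1 = []) (z : Metric.closedBall (0 : ℂ) 1)
      (hz : ‖z.1‖ = 1) : Glue (disc g r z) (vert g)

end CayleyCells

/-- The Cayley 2-complex of `⟨A | R⟩`, with the quotient topology. -/
abbrev CayleyComplex {A : Type*} (R : Set (List (A × Bool))) : Type _ :=
  Quot (CayleyCells.Glue (R := R))

/-- The vertex `g` of the Cayley 2-complex. -/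
def CayleyComplex.vert {A : Type*} {R : Set (List (A × Bool))} (g : GroupOf R) :
    CayleyComplex R :=
  Quot.mk _ (CayleyCells.vert g)

/-- The point at time `s` of the edge labelled `a` from `g` to `g * a` in the Cayley 2-complex. -/
def CayleyComplex.edge {A : Type*} {R : Set (List (A × Bool))} (g : GroupOf R) (a : A)
    (s : unitInterval) : CayleyComplex R :=
  Quot.mk _ (CayleyCells.edge g a s)

/-! ### The 1-skeleton of a CW complex in the plane -/

/-- A directed edge is a 1-cell with a direction: `(c, true)` is `c` traversed in the direction of
its characteristic map, which is defined on `[-1, 1]`, and `(c, false)` is `c` reversed. -/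
abbrev DirEdge (C : Set Plane) [CWComplex C] : Type :=
  RelCWComplex.cell C 1 × Bool

namespace DirEdge

variable {C : Set Plane} [CWComplex C]

/-- The point at time `s ∈ [0, 1]` of a directed edge. -/
def pt (d : DirEdge C) (s : unitInterval) : Plane :=
  if d.2 then RelCWComplex.map 1 d.1 (fun _ => 2 * (s : ℝ) - 1)
  else RelCWComplex.map 1 d.1 (fun _ => 1 - 2 * (s : ℝ))

/-- The initial vertex of a directed edge. -/
def source (d : DirEdge C) : Plane := d.pt 0

/-- The terminal vertex of a directed edge. -/
def target (d : DirEdge C) : Plane := d.pt 1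

/-- The closed 1-cell underlying a directed edge. -/
def support (d : DirEdge C) : Set Plane := RelCWComplex.closedCell 1 d.1

end DirEdge

/-- The vertices of the complex, as points of the plane. -/
def vertexSet (C : Set Plane) [CWComplex C] : Set Plane :=
  Set.range fun v : RelCWComplex.cell C 0 => RelCWComplex.map 0 v 0

lemma map_zero_image {C : Set Plane} [CWComplex C] (v : RelCWComplex.cell C 0) :
    RelCWComplex.closedCell 0 v = {RelCWComplex.map 0 v 0} := by
  rw [CWComplex.closedCell_zero_eq_singleton]
  congr 2
  exact Subsingleton.elim _ _

lemma mem_vertexSet_of_sphere {C : Set Plane} [CWComplex C] (c : RelCWComplex.cell C 1)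
    {z : Fin 1 → ℝ} (hz : z ∈ Metric.sphere (0 : Fin 1 → ℝ) 1) :
    RelCWComplex.map 1 c z ∈ vertexSet C := by
  obtain ⟨I, hI⟩ := CWComplex.mapsTo (C := C) 1 c
  have h := hI hz
  simp only [Set.mem_iUnion] at h
  obtain ⟨m, hm, j, -, hj⟩ := h
  obtain rfl : m = 0 := by omega
  have hj' : RelCWComplex.map 1 c z ∈ RelCWComplex.closedCell 0 j := hj
  rw [map_zero_image] at hj'
  exact ⟨j, hj'.symm⟩

lemma DirEdge.source_mem {C : Set Plane} [CWComplex C] (d : DirEdge C) :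
    d.source ∈ vertexSet C := by
  unfold DirEdge.source DirEdge.pt
  split_ifs <;> refine mem_vertexSet_of_sphere _ ?_ <;> norm_num [pi_norm_const]

lemma DirEdge.target_mem {C : Set Plane} [CWComplex C] (d : DirEdge C) :
    d.target ∈ vertexSet C := by
  unfold DirEdge.target DirEdge.pt
  split_ifs <;> refine mem_vertexSet_of_sphere _ ?_ <;> norm_num [pi_norm_const]

/-- The list of directed edges `l` is an edge path from `u` to `v`. -/
def IsEdgePath {C : Set Plane} [CWComplex C] : Plane → List (DirEdge C) → Plane → Prop
  | u, [], v => u = v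
  | u, d :: l, v => d.source = u ∧ IsEdgePath d.target l v

/-- The edge path `l` from `u` to `v` uses only 1-cells of `T` and visits no vertex twice. -/
def IsSimplePathIn {C : Set Plane} [CWComplex C] (T : Set (RelCWComplex.cell C 1)) (u : Plane)
    (l : List (DirEdge C)) (v : Plane) : Prop :=
  IsEdgePath u l v ∧ (∀ d ∈ l, d.1 ∈ T) ∧ (u :: l.map DirEdge.target).Nodup

/-- The nonempty closed edge path `l` based at `u` uses only 1-cells of `T`, uses no 1-cell twice
and visits no vertex twice, except that it ends where it starts. A loop, and two parallel 1-cells,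
form simple circuits. -/
def IsSimpleCircuitIn {C : Set Plane} [CWComplex C] (T : Set (RelCWComplex.cell C 1)) (u : Plane)
    (l : List (DirEdge C)) : Prop :=
  l ≠ [] ∧ IsEdgePath u l u ∧ (∀ d ∈ l, d.1 ∈ T) ∧ (l.map Prod.fst).Nodup ∧
    (l.map DirEdge.target).Nodup

/-- The 1-cells in `T`, together with all vertices of the complex, form a tree. -/
structure IsSpanningTree (C : Set Plane) [CWComplex C] (T : Set (RelCWComplex.cell C 1)) : Prop where
  connected : ∀ u ∈ vertexSet C, ∀ v ∈ vertexSet C,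
    ∃ l : List (DirEdge C), IsEdgePath u l v ∧ ∀ d ∈ l, d.1 ∈ T
  acyclic : ∀ u (l : List (DirEdge C)), ¬ IsSimpleCircuitIn T u l

lemma IsSimplePathIn.exists_suffix {C : Set Plane} [CWComplex C] {T : Set (RelCWComplex.cell C 1)} :
    ∀ {l : List (DirEdge C)} {u v w : Plane}, IsSimplePathIn T u l v →
      w ∈ u :: l.map DirEdge.target → ∃ l', IsSimplePathIn T w l' v
  | [], u, v, w, h, hw => by
      obtain rfl : w = u := by simpa using hw
      exact ⟨[], h⟩
  | d :: l, u, v, w, h, hw => by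
      rcases List.mem_cons.1 hw with rfl | hw
      · exact ⟨_, h⟩
      · exact IsSimplePathIn.exists_suffix (l := l) (u := d.target)
          ⟨h.1.2, fun d' hd' => h.2.1 d' (List.mem_cons_of_mem _ hd'),
            (List.nodup_cons.1 h.2.2).2⟩ hw

lemma IsEdgePath.exists_simple {C : Set Plane} [CWComplex C] {T : Set (RelCWComplex.cell C 1)} :
    ∀ {l : List (DirEdge C)} {u v : Plane}, IsEdgePath u l v → (∀ d ∈ l, d.1 ∈ T) →
      ∃ l', IsSimplePathIn T u l' v
  | [], u, v, h, _ => ⟨[], h, by simp, by simp⟩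
  | d :: l, u, v, h, hT => by
      obtain ⟨l', hl'⟩ := IsEdgePath.exists_simple (l := l) (T := T) h.2
        fun d' hd' => hT d' (List.mem_cons_of_mem _ hd')
      by_cases hu : u ∈ d.target :: l'.map DirEdge.target
      · exact hl'.exists_suffix hu
      · refine ⟨d :: l', ⟨h.1, hl'.1⟩, ?_, List.nodup_cons.2 ⟨hu, hl'.2.2⟩⟩
        intro d' hd'
        rcases List.mem_cons.1 hd' with rfl | hd'
        · exact hT _ (by simp)
        · exact hl'.2.1 d' hd'

lemma IsSpanningTree.exists_simplePath {C : Set Plane} [CWComplex C]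
    {T : Set (RelCWComplex.cell C 1)} (hT : IsSpanningTree C T) {u v : Plane}
    (hu : u ∈ vertexSet C) (hv : v ∈ vertexSet C) : ∃ l, IsSimplePathIn T u l v := by
  obtain ⟨l, hl, hlT⟩ := hT.connected u hu v hv
  exact hl.exists_simple hlT

/-- The simple edge path in a spanning tree from the vertex `u` to the vertex `v`; there is exactly
one, because a tree contains no simple circuit. -/
def IsSpanningTree.path {C : Set Plane} [CWComplex C] {T : Set (RelCWComplex.cell C 1)}
    (hT : IsSpanningTree C T) {u v : Plane} (hu : u ∈ vertexSet C) (hv : v ∈ vertexSet C) :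
    List (DirEdge C) :=
  (hT.exists_simplePath hu hv).choose

/-! ### Van Kampen diagrams -/

/-- A van Kampen diagram over `⟨A | R⟩`: a finite contractible 2-complex in the plane with a
base vertex on its topological boundary, a label for each 1-cell, and a cellular map to the Cayley
2-complex that preserves the directions and labels of the edges. The map to the Cayley complex is
given on the whole plane, but only its restriction to the diagram matters. -/
structure VanKampenDiagram {A : Type*} (R : Set (List (A × Bool))) where
  /-- The underlying subspace of the plane. -/
  carrier : Set Plane
  /-- The cell structure. -/
  [cw : CWComplex carrier]
  finite : RelCWComplex.Finite carrier
  two_dimensional : ∀ n, 2 < n → IsEmpty (RelCWComplex.cell carrier n)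
  contractible : ContractibleSpace carrier
  /-- The basepoint. -/
  base : Plane
  base_mem_vertexSet : base ∈ vertexSet carrier
  base_mem_frontier : base ∈ frontier carrier
  /-- The generator `a` that labels one of the two directed edges of a 1-cell; the reverse of that
  directed edge is labelled `a⁻¹`. -/
  label : RelCWComplex.cell carrier 1 → A
  /-- The direction in which the 1-cell is labelled by a generator. -/
  dir : RelCWComplex.cell carrier 1 → Bool
  /-- The map to the Cayley complex. -/
  proj : Plane → CayleyComplex R
  proj_continuousOn : ContinuousOn proj carrier
  /-- Vertices go to vertices. -/
  proj_vertex : ∀ v ∈ vertexSet carrier, ∃ g : GroupOf R, proj v = CayleyComplex.vert g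
  /-- Each directed edge labelled `a` goes, up to a monotone reparametrization, to an edge labelled
  `a`. In particular the 1-skeleton goes to the 1-skeleton. -/
  proj_edge : ∀ c : RelCWComplex.cell carrier 1, ∃ (g : GroupOf R) (φ : C(unitInterval, unitInterval)),
    Monotone φ ∧ φ 0 = 0 ∧ φ 1 = 1 ∧
      ∀ s, proj (DirEdge.pt (c, dir c) s) = CayleyComplex.edge g (label c) (φ s)

attribute [instance] VanKampenDiagram.cw

/-! ### Icicles -/

open Classical in
/-- The longest common initial segment of two lists. -/
def commonPrefix {α : Type*} : List α → List α → List α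
  | a :: l, b :: m => if a = b then a :: commonPrefix l m else []
  | _, _ => []

/-- The inside of a simple closed curve `S` in the plane: the union of the bounded connected
components of the complement of `S`. -/
def inside (S : Set Plane) : Set Plane :=
  {p | p ∉ S ∧ Bornology.IsBounded (connectedComponentIn Sᶜ p)}

/-- The set of points on an edge path. -/
def pathSupport {C : Set Plane} [CWComplex C] (l : List (DirEdge C)) : Set Plane :=
  ⋃ d ∈ l, d.support

namespace VanKampenDiagram

variable {A : Type*} {R : Set (List (A × Bool))} (Δ : VanKampenDiagram R)

/-- The 1-cells of the diagram. -/
abbrev Edge : Type := RelCWComplex.cell Δ.carrier 1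

/-- The closed 1-cell `e`, as a subset of the plane. -/
def edgeSet (e : Δ.Edge) : Set Plane := RelCWComplex.closedCell 1 e

variable {Δ} {T : Set Δ.Edge} (hT : IsSpanningTree Δ.carrier T) (e : Δ.Edge)

/-- The simple path `γ_x` in the tree from the basepoint to the initial vertex `x` of `e`. -/
def gammaX : List (DirEdge Δ.carrier) :=
  hT.path Δ.base_mem_vertexSet (DirEdge.source_mem (e, true))

/-- The simple path `γ_y` in the tree from the basepoint to the terminal vertex `y` of `e`. -/
def gammaY : List (DirEdge Δ.carrier) :=
  hT.path Δ.base_mem_vertexSet (DirEdge.target_mem (e, true))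

/-- The longest initial segment `α` on which `γ_x` and `γ_y` agree. -/
def alpha : List (DirEdge Δ.carrier) := commonPrefix (gammaX hT e) (gammaY hT e)

/-- The path `β_x` with `γ_x = α · β_x`. -/
def betaX : List (DirEdge Δ.carrier) := (gammaX hT e).drop (alpha hT e).length

/-- The path `β_y` with `γ_y = α · β_y`. -/
def betaY : List (DirEdge Δ.carrier) := (gammaY hT e).drop (alpha hT e).length

/-- The set of points on the simple circuit `η = β_x · e · β_y⁻¹`. -/
def eta : Set Plane := pathSupport (betaX hT e) ∪ Δ.edgeSet e ∪ pathSupport (betaY hT e)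

/-- The tail of the icicle: the set of points on `α`, a path that starts at the basepoint and may
be trivial. -/
def tail : Set Plane := {Δ.base} ∪ pathSupport (alpha hT e)

/-- The body of the icicle: the circuit `η` together with its inside. -/
def body : Set Plane := eta hT e ∪ inside (eta hT e)

/-- The icicle at `e` with respect to the spanning tree `T`. -/
def icicle : Set Plane := tail hT e ∪ body hT e

end VanKampenDiagram

end

/-! The Jordan curve theorem is not needed: `inside` collects all bounded complementary components,
and the topological input is one half of Borsuk's separation criterion. If every nowhere vanishing
continuous function on a closed set `K` has a continuous logarithm, then a bounded open set with
frontier in `K` lies in `K` (`HasContinuousLogs.subset_of_frontier_subset`). This is applied to the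
contractible diagram and to the union of two tree paths.

Applied to the diagram, it puts the open set `inside η` within `Δ`, so the basepoint, being on the
frontier, is not inside `η`. A tree path from the basepoint to a vertex of the body must therefore
visit `η`; up to that visit it is `α` followed by a part of `η`, and afterwards it stays in the body
(`exists_eq_append_of_mem_body`).

For nesting, apply this to both ends of `e'`. Both tree paths begin with `α`, so `α` is an initial
segment of the `α'` of `e'`, and everything after it, in particular the circuit `η'` of `e'`, lies
in the body of `e`; the inside of `η'` follows.

For disjointness, a tree path that enters `inside η` never returns to `η` (`end_mem_inside`). If
`η'` met `inside η`, an end of `e'` would be inside and `e'` would lie in the body. So neither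
circuit meets the inside of the other, and at a common inside point `p` the two complementary
components coincide. Their frontier lies in `η ∩ η'`, hence in two tree paths; these meet in a
connected initial segment, so their union has continuous logarithms and contains `p`. Thus the
icicles meet only in the 1-skeleton, which has empty interior. -/

/-! ### Continuous logarithms and bounded complementary regions -/

/-- Every continuous nowhere vanishing complex function on `K` has a continuous logarithm. -/
def HasContinuousLogs {X : Type*} [TopologicalSpace X] (K : Set X) : Prop :=
  ∀ f : X → ℂ, ContinuousOn f K → (∀ z ∈ K, f z ≠ 0) →
    ∃ g : X → ℂ, ContinuousOn g K ∧ ∀ z ∈ K, Complex.exp (g z) = f z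

/-- The contraction is run backwards, from a constant map to the identity, and its composite with
`f` is lifted through the covering `exp : ℂ → ℂ \ {0}`. The lift starts at a constant logarithm and
ends at a logarithm of `f`. -/
lemma ContractibleSpace.exists_continuous_log {X : Type*} [TopologicalSpace X] [ContractibleSpace X]
    (f : X → ℂ) (hf : Continuous f) (h0 : ∀ x, f x ≠ 0) :
    ∃ g : X → ℂ, Continuous g ∧ ∀ x, Complex.exp (g x) = f x := by
  obtain ⟨y, ⟨H⟩⟩ := id_nullhomotopic X
  let F : C(unitInterval × X, {z : ℂ // z ≠ 0}) :=
    ⟨fun q => ⟨f (H.symm q), h0 _⟩, by fun_prop⟩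
  let c : C(X, ℂ) := ContinuousMap.const X (Complex.log (f y))
  have hF0 : ∀ x, F (0, x) = ⟨_, (c x).exp_ne_zero⟩ := fun x => by
    apply Subtype.ext
    simp [F, c, Complex.exp_log (h0 y)]
  let G := Complex.isCoveringMap_exp.liftHomotopy F c hF0
  refine ⟨fun x => G (1, x), by fun_prop, fun x => ?_⟩
  have h := congrFun (Complex.isCoveringMap_exp.liftHomotopy_lifts F c hF0) (1, x)
  exact (congrArg Subtype.val h).trans (by simp [F])

lemma hasContinuousLogs_of_contractible {X : Type*} [TopologicalSpace X] {K : Set X}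
    [ContractibleSpace K] : HasContinuousLogs K := by
  intro f hf h0
  obtain ⟨g, hg, hgf⟩ := ContractibleSpace.exists_continuous_log (fun x : K => f x)
    (continuousOn_iff_continuous_domRestrict.1 hf) fun x => h0 x x.2
  classical
  refine ⟨fun x => if h : x ∈ K then g ⟨x, h⟩ else 0, ?_, fun z hz => ?_⟩
  · rw [continuousOn_iff_continuous_domRestrict]
    convert hg using 1
    ext x
    simp
  · simp [hz, hgf]

lemma IsPreconnected.eq_of_exp_eq_one {X : Type*} [TopologicalSpace X] {S : Set X}
    (hS : IsPreconnected S) {h : X → ℂ} (hh : ContinuousOn h S)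
    (h1 : ∀ x ∈ S, Complex.exp (h x) = 1) {x y : X} (hx : x ∈ S) (hy : y ∈ S) : h x = h y := by
  have hc : (Set.range fun n : ℤ => (n * (2 * Real.pi * Complex.I) : ℂ)).Countable :=
    Set.countable_range _
  refine hc.isTotallyDisconnected (h '' S) ?_ (hS.image h hh) ⟨x, hx, rfl⟩ ⟨y, hy, rfl⟩
  rintro _ ⟨z, hz, rfl⟩
  obtain ⟨n, hn⟩ := Complex.exp_eq_one_iff.1 (h1 z hz)
  exact ⟨n, hn.symm⟩

/-- On the connected overlap two logarithms differ by a constant in `2πiℤ`; shifting one of them by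
it makes them glue. -/
lemma HasContinuousLogs.union {X : Type*} [TopologicalSpace X] {K L : Set X}
    (hK : HasContinuousLogs K) (hL : HasContinuousLogs L) (hKc : IsClosed K) (hLc : IsClosed L)
    (hKL : IsPreconnected (K ∩ L)) : HasContinuousLogs (K ∪ L) := by
  intro f hf h0
  obtain ⟨g, hg, hgf⟩ := hK f (hf.mono Set.subset_union_left) fun z hz => h0 z (Or.inl hz)
  obtain ⟨k, hk, hkf⟩ := hL f (hf.mono Set.subset_union_right) fun z hz => h0 z (Or.inr hz)
  obtain ⟨c, hc, hgk⟩ : ∃ c : ℂ, Complex.exp c = 1 ∧ ∀ z ∈ K ∩ L, g z = k z + c := by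
    rcases (K ∩ L).eq_empty_or_nonempty with h | ⟨w, hw⟩
    · exact ⟨0, by simp, by simp [h]⟩
    have hexp : ∀ z ∈ K ∩ L, Complex.exp (g z - k z) = 1 := fun z hz => by
      rw [Complex.exp_sub, hgf z hz.1, hkf z hz.2, div_self (h0 z (Or.inl hz.1))]
    refine ⟨g w - k w, hexp w hw, fun z hz => ?_⟩
    have := hKL.eq_of_exp_eq_one
      ((hg.mono Set.inter_subset_left).sub (hk.mono Set.inter_subset_right)) hexp hw hz
    simp only [Pi.sub_apply] at this
    rw [this]; ring
  classical
  have hgK : ∀ z ∈ K, (if z ∈ K then g z else k z + c) = g z := fun z hz => if_pos hz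
  have hkL : ∀ z ∈ L, (if z ∈ K then g z else k z + c) = k z + c := fun z hz => by
    by_cases hzK : z ∈ K
    · rw [if_pos hzK, hgk z ⟨hzK, hz⟩]
    · rw [if_neg hzK]
  refine ⟨fun z => if z ∈ K then g z else k z + c, ?_, ?_⟩
  · exact ContinuousOn.union_of_isClosed (hg.congr hgK)
      ((hk.add continuousOn_const).congr hkL) hKc hLc
  · rintro z (hz | hz) <;> beta_reduce
    · rw [hgK z hz, hgf z hz]
    · rw [hkL z hz, Complex.exp_add, hc, mul_one, hkf z hz]

/-- Winding number argument: the plane is contractible, so `F` has a global logarithm, yet along a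
large circle about `p` that logarithm must increase by `2πi`. -/
lemma not_continuous_log_of_eq_outside (p : Plane) (r : ℝ) (F : Plane → ℂ) (hF : Continuous F)
    (h0 : ∀ z, F z ≠ 0)
    (hr : ∀ z, r < ‖z - p‖ → F z = Complex.orthonormalBasisOneI.repr.symm (z - p)) : False := by
  obtain ⟨H, hH, hHF⟩ := ContractibleSpace.exists_continuous_log F hF h0
  let ι := Complex.orthonormalBasisOneI.repr
  -- The radius has to exceed `r` and be positive even when `r` is negative.
  set R : ℝ := |r| + 1 with hR
  have hRpos : 0 < R := by positivity
  let z : ℝ → Plane := fun θ => p + ι (R * Complex.exp (θ * Complex.I))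
  have hz : Continuous z := by fun_prop
  have hFz : ∀ θ, F (z θ) = R * Complex.exp (θ * Complex.I) := fun θ => by
    rw [hr]
    · simp [z, ι]
    · simp only [z, add_sub_cancel_left, LinearIsometryEquiv.norm_map, norm_mul,
        Complex.norm_exp_ofReal_mul_I, mul_one, Complex.norm_real, Real.norm_eq_abs,
        abs_of_pos hRpos]
      linarith [le_abs_self r]
  have hexp : ∀ θ ∈ (Set.univ : Set ℝ),
      Complex.exp (H (z θ) - θ * Complex.I - Complex.log R) = 1 := fun θ _ => by
    have hRC : (R : ℂ) ≠ 0 := by exact_mod_cast hRpos.ne'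
    rw [Complex.exp_sub, Complex.exp_sub, hHF, hFz, Complex.exp_log hRC]
    field_simp [Complex.exp_ne_zero]
  have hcont : ContinuousOn (fun θ : ℝ => H (z θ) - θ * Complex.I - Complex.log R) Set.univ :=
    Continuous.continuousOn (by fun_prop)
  have h := isPreconnected_univ.eq_of_exp_eq_one hcont hexp (Set.mem_univ 0)
    (Set.mem_univ (2 * Real.pi))
  have hzz : z 0 = z (2 * Real.pi) := by
    simp [z, Complex.exp_two_pi_mul_I]
  rw [hzz] at h
  have : (2 * Real.pi * Complex.I : ℂ) = 0 := by
    push_cast at h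
    linear_combination h
  exact Complex.two_pi_I_ne_zero this

/-- A bounded open set whose frontier lies in a closed set with continuous logarithms is contained
in that set. -/
lemma HasContinuousLogs.subset_of_frontier_subset {K V : Set Plane} (hK : HasContinuousLogs K)
    (hKc : IsClosed K) (hVb : Bornology.IsBounded V) (hVK : frontier V ⊆ K) : V ⊆ K := by
  intro p hpV
  by_contra hpK
  let ι := Complex.orthonormalBasisOneI.repr
  have hι0 : ∀ z, ι.symm (z - p) = 0 → z = p := fun z hz => by
    simpa [sub_eq_zero] using hz
  obtain ⟨g, hg, hgf⟩ := hK (fun z => ι.symm (z - p))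
    (by fun_prop) fun z hz h => hpK (hι0 z h ▸ hz)
  -- Tietze extension of the logarithm of `z - p` from `K` to the plane.
  obtain ⟨G, hG⟩ := ContinuousMap.exists_restrict_eq hKc
    ⟨K.domRestrict g, continuousOn_iff_continuous_domRestrict.1 hg⟩
  have hGg : ∀ z ∈ K, G z = g z := fun z hz => DFunLike.congr_fun hG ⟨z, hz⟩
  classical
  obtain ⟨r, hr⟩ := hVb.subset_closedBall p
  -- Replacing `z - p` by `exp G` on `V` removes its only zero `p`. The two formulas agree on
  -- `frontier V ⊆ K`, so the result is continuous.
  refine not_continuous_log_of_eq_outside p r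
    (fun z => if z ∈ V then Complex.exp (G z) else ι.symm (z - p)) ?_ ?_ ?_
  · refine Continuous.if (fun z hz => ?_) (by fun_prop) (by fun_prop)
    rw [hGg z (hVK hz), hgf z (hVK hz)]
  · intro z
    split_ifs with h
    · exact Complex.exp_ne_zero _
    · exact fun h0 => h (hι0 z h0 ▸ hpV)
  · intro z hz
    refine if_neg fun hzV => ?_
    have := hr hzV
    rw [Metric.mem_closedBall, dist_eq_norm] at this
    linarith

/-! ### Insides -/

lemma frontier_connectedComponentIn_compl_subset {S : Set Plane} (hS : IsClosed S) (p : Plane) :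
    frontier (connectedComponentIn Sᶜ p) ⊆ S := by
  intro q hq
  by_contra hqS
  have hopen : ∀ x, IsOpen (connectedComponentIn Sᶜ x) := fun x =>
    hS.isOpen_compl.connectedComponentIn
  have hqq : q ∈ connectedComponentIn Sᶜ q := mem_connectedComponentIn hqS
  obtain ⟨w, hwq, hwp⟩ := mem_closure_iff.1 hq.1 _ (hopen q) hqq
  have h := (connectedComponentIn_eq hwq).trans (connectedComponentIn_eq hwp).symm
  rw [(hopen p).frontier_eq] at hq
  exact hq.2 (h ▸ hqq)

/-- A connected set disjoint from `S` that meets the inside of `S` lies in it. -/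
lemma IsPreconnected.subset_inside {S N : Set Plane} (hN : IsPreconnected N) (hNS : Disjoint N S)
    (h : (N ∩ inside S).Nonempty) : N ⊆ inside S := by
  obtain ⟨q, hqN, hq⟩ := h
  have hsub := hN.subset_connectedComponentIn hqN hNS.subset_compl_right
  exact fun x hx => ⟨hNS.subset_compl_right hx, connectedComponentIn_eq (hsub hx) ▸ hq.2⟩

lemma isOpen_inside {S : Set Plane} (hS : IsClosed S) : IsOpen (inside S) := by
  rw [isOpen_iff_mem_nhds]
  intro p hp
  refine Filter.mem_of_superset
    (hS.isOpen_compl.connectedComponentIn.mem_nhds (mem_connectedComponentIn hp.1)) ?_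
  exact isPreconnected_connectedComponentIn.subset_inside
    (Set.disjoint_left.2 fun x hx => connectedComponentIn_subset _ _ hx)
    ⟨p, mem_connectedComponentIn hp.1, hp⟩

lemma closure_inside_subset {S : Set Plane} (hS : IsClosed S) : closure (inside S) ⊆ S ∪ inside S := by
  intro q hq
  by_contra h
  rw [Set.mem_union, not_or] at h
  have hqq : q ∈ connectedComponentIn Sᶜ q := mem_connectedComponentIn h.1
  obtain ⟨w, hwq, hw⟩ := mem_closure_iff.1 hq _ hS.isOpen_compl.connectedComponentIn hqq
  exact h.2 (isPreconnected_connectedComponentIn.subset_inside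
    (Set.disjoint_left.2 fun x hx => connectedComponentIn_subset _ _ hx) ⟨w, hwq, hw⟩ hqq)

lemma isClosed_union_inside {S : Set Plane} (hS : IsClosed S) : IsClosed (S ∪ inside S) := by
  rw [← closure_subset_iff_isClosed, closure_union, hS.closure_eq]
  exact Set.union_subset Set.subset_union_left (closure_inside_subset hS)

/-- A set with continuous logarithms contains the inside of each of its closed subsets. -/
lemma HasContinuousLogs.inside_subset {K S : Set Plane} (hK : HasContinuousLogs K)
    (hKc : IsClosed K) (hS : IsClosed S) (hSK : S ⊆ K) : inside S ⊆ K := fun p hp =>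
  hK.subset_of_frontier_subset hKc hp.2
    ((frontier_connectedComponentIn_compl_subset hS p).trans hSK) (mem_connectedComponentIn hp.1)

/-- If `S'` lies in `S` together with its inside, then so does the inside of `S'`. -/
lemma inside_subset_of_subset {S S' : Set Plane} (h : S' ⊆ S ∪ inside S) :
    inside S' ⊆ S ∪ inside S := by
  intro p hp
  by_contra hpS
  rw [Set.mem_union, not_or] at hpS
  -- The component of `p` in `Sᶜ` is unbounded and misses both `S` and `inside S`, hence `S'`. It
  -- would then sit in the bounded component of `p` in `S'ᶜ`.
  have hdisj : Disjoint (connectedComponentIn Sᶜ p) S' := by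
    refine Set.disjoint_left.2 fun x hx hxS' => ?_
    rcases h hxS' with hxS | hxS
    · exact connectedComponentIn_subset _ _ hx hxS
    · refine hpS.2 ⟨hpS.1, ?_⟩
      rw [connectedComponentIn_eq hx]
      exact hxS.2
  refine hpS.2 ⟨hpS.1, hp.2.subset ?_⟩
  exact isPreconnected_connectedComponentIn.subset_connectedComponentIn
    (mem_connectedComponentIn hpS.1) hdisj.subset_compl_right

/-- If neither of two closed sets meets the inside of the other, then their insides are disjoint off
each set with continuous logarithms that contains their intersection. -/
lemma HasContinuousLogs.inside_inter_inside_subset {K S S' : Set Plane} (hK : HasContinuousLogs K)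
    (hKc : IsClosed K) (hS : IsClosed S) (hS' : IsClosed S') (hSS' : S ∩ S' ⊆ K)
    (h : Disjoint S (inside S')) (h' : Disjoint S' (inside S)) : inside S ∩ inside S' ⊆ K := by
  rintro p ⟨hp, hp'⟩
  -- The component of `Aᶜ` at `p` lies in `inside A`, which `B` misses. By symmetry the two
  -- components at `p` are equal, so their frontier lies in `S ∩ S'`.
  have key : ∀ {A B : Set Plane}, Disjoint B (inside A) → p ∈ inside A → p ∈ inside B →
      connectedComponentIn Aᶜ p ⊆ connectedComponentIn Bᶜ p := fun {A B} hBA hA _ => by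
    refine isPreconnected_connectedComponentIn.subset_connectedComponentIn
      (mem_connectedComponentIn hA.1) fun x hx => ?_
    refine Set.disjoint_right.1 hBA ?_
    exact isPreconnected_connectedComponentIn.subset_inside
      (Set.disjoint_left.2 fun x hx => connectedComponentIn_subset _ _ hx)
      ⟨p, mem_connectedComponentIn hA.1, hA⟩ hx
  have heq := (key h' hp hp').antisymm (key h hp' hp)
  refine hK.subset_of_frontier_subset hKc hp.2 (fun q hq => hSS' ⟨?_, ?_⟩)
    (mem_connectedComponentIn hp.1)
  · exact frontier_connectedComponentIn_compl_subset hS p hq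
  · exact frontier_connectedComponentIn_compl_subset hS' p (heq ▸ hq)

/-! ### Arcs have empty interior -/

/-- The plane without `y` is connected, so its image is an interval; if `f y` lies strictly between
two values, injectivity would leave a gap in it. -/
lemma not_injective_of_continuous_plane (f : Plane → ℝ) (hf : Continuous f) :
    ¬ Function.Injective f := by
  intro hinj
  have hrank : 1 < Module.rank ℝ Plane := by
    rw [← Module.finrank_eq_rank]; simp
  obtain ⟨x, y, z, hxy, hyz⟩ : ∃ x y z : Plane, f x < f y ∧ f y < f z := by
    let a : Fin 3 → Plane := fun i => EuclideanSpace.single 0 (i : ℝ)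
    have hne : ∀ i j : Fin 3, i ≠ j → f (a i) ≠ f (a j) := fun i j hij h => hij <| by
      have := congrArg (fun v : Plane => v 0) (hinj h)
      simp only [a, PiLp.single_apply, if_true] at this
      exact Fin.ext (by exact_mod_cast this)
    have h01 := hne 0 1 (by decide)
    have h02 := hne 0 2 (by decide)
    have h12 := hne 1 2 (by decide)
    rcases lt_or_gt_of_ne h01 with h | h <;> rcases lt_or_gt_of_ne h02 with h' | h' <;>
      rcases lt_or_gt_of_ne h12 with h'' | h''
    all_goals first
      | exact ⟨_, _, _, h, h''⟩ | exact ⟨_, _, _, h'', h⟩ | exact ⟨_, _, _, h, h'⟩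
      | exact ⟨_, _, _, h', h⟩ | exact ⟨_, _, _, h', h''⟩ | exact ⟨_, _, _, h'', h'⟩
  have hconn := ((isConnected_compl_singleton_of_one_lt_rank hrank y).isPreconnected.image f
    hf.continuousOn).ordConnected
  obtain ⟨w, hw, hwy⟩ := hconn.out (Set.mem_image_of_mem f (fun h => hxy.ne (congrArg f h)))
    (Set.mem_image_of_mem f (fun h => hyz.ne' (congrArg f h))) ⟨hxy.le, hyz.le⟩
  exact hw (hinj hwy)

/-- A ball in `S` is homeomorphic to the plane and would yield a continuous injection of the plane
into `ℝ`. -/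
lemma interior_eq_empty_of_injOn {S : Set Plane} (f : Plane → ℝ) (hf : ContinuousOn f S)
    (hinj : Set.InjOn f S) : interior S = ∅ := by
  by_contra h
  obtain ⟨x, hx⟩ := Set.nonempty_iff_ne_empty.2 h
  obtain ⟨r, hr, hball⟩ := Metric.isOpen_iff.1 isOpen_interior x hx
  let φ := OpenPartialHomeomorph.univBall x r
  have hsource : φ.source = Set.univ := OpenPartialHomeomorph.univBall_source x r
  have htarget : φ.target = Metric.ball x r := OpenPartialHomeomorph.univBall_target x hr
  have hmaps : ∀ y, φ y ∈ S := fun y => interior_subset (hball (by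
    rw [← htarget]; exact φ.map_source (by simp [hsource])))
  refine not_injective_of_continuous_plane (fun y => f (φ y)) ?_ fun y y' hy => ?_
  · exact hf.comp_continuous (OpenPartialHomeomorph.continuous_univBall x r) hmaps
  · exact φ.injOn (by simp [hsource]) (by simp [hsource]) (hinj (hmaps y) (hmaps y') hy)

/-! ### Closed and open 1-cells -/

section Cells

variable {C : Set Plane} [CWComplex C]

lemma isClosed_closedCell_one (c : RelCWComplex.cell C 1) :
    IsClosed (RelCWComplex.closedCell 1 c) :=
  RelCWComplex.isClosed_closedCell

lemma closure_openCell_one (c : RelCWComplex.cell C 1) :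
    closure (RelCWComplex.openCell 1 c) = RelCWComplex.closedCell 1 c :=
  RelCWComplex.closure_openCell_eq_closedCell

lemma isPreconnected_openCell_one (c : RelCWComplex.cell C 1) :
    IsPreconnected (RelCWComplex.openCell 1 c) :=
  (convex_ball (0 : Fin 1 → ℝ) 1).isPreconnected.image _
    ((RelCWComplex.continuousOn 1 c).mono Metric.ball_subset_closedBall)

lemma isPreconnected_closedCell_one (c : RelCWComplex.cell C 1) :
    IsPreconnected (RelCWComplex.closedCell 1 c) :=
  closure_openCell_one c ▸ (isPreconnected_openCell_one c).closure

lemma vertexSet_disjoint_openCell (c : RelCWComplex.cell C 1) :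
    Disjoint (vertexSet C) (RelCWComplex.openCell 1 c) := by
  rw [Set.disjoint_left]
  rintro _ ⟨v, rfl⟩
  have h : Disjoint (RelCWComplex.openCell 0 v) (RelCWComplex.openCell 1 c) :=
    RelCWComplex.disjoint_openCell_of_ne fun h => by
      have := congrArg Sigma.fst h
      simp at this
  exact Set.disjoint_left.1 h (RelCWComplex.map_zero_mem_openCell 0 v)

lemma DirEdge.support_eq (d : DirEdge C) :
    d.support = RelCWComplex.openCell 1 d.1 ∪ {d.source, d.target} := by
  have h : RelCWComplex.cellFrontier 1 d.1 = {d.source, d.target} := by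
    rw [RelCWComplex.cellFrontier_one_eq, Set.image_pair]
    have h1 : (fun _ => 1 : Fin 1 → ℝ) = 1 := rfl
    have h2 : (fun _ => -1 : Fin 1 → ℝ) = -1 := rfl
    rcases d with ⟨c, _ | _⟩
    · rw [Set.pair_comm]
      norm_num [DirEdge.source, DirEdge.target, DirEdge.pt, h1, h2]
    · norm_num [DirEdge.source, DirEdge.target, DirEdge.pt, h1, h2]
  rw [← h, Set.union_comm]
  exact (RelCWComplex.cellFrontier_union_openCell_eq_closedCell 1 d.1).symm

lemma DirEdge.source_mem_support (d : DirEdge C) : d.source ∈ d.support := by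
  rw [d.support_eq]; simp

lemma DirEdge.target_mem_support (d : DirEdge C) : d.target ∈ d.support := by
  rw [d.support_eq]; simp

lemma DirEdge.eq_source_or_target {d : DirEdge C} {w : Plane} (hw : w ∈ vertexSet C)
    (h : w ∈ d.support) : w = d.source ∨ w = d.target := by
  rw [d.support_eq] at h
  exact h.resolve_left (Set.disjoint_left.1 (vertexSet_disjoint_openCell d.1) hw)

lemma DirEdge.mem_openCell_or_vertexSet {d : DirEdge C} {q : Plane} (h : q ∈ d.support) :
    q ∈ RelCWComplex.openCell 1 d.1 ∨ q ∈ vertexSet C := by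
  rw [d.support_eq] at h
  rcases h with h | rfl | rfl
  · exact Or.inl h
  · exact Or.inr d.source_mem
  · exact Or.inr d.target_mem

lemma eq_of_mem_openCell_of_mem_support {c : RelCWComplex.cell C 1} {d : DirEdge C} {q : Plane}
    (hc : q ∈ RelCWComplex.openCell 1 c) (hd : q ∈ d.support) : c = d.1 := by
  rcases d.mem_openCell_or_vertexSet hd with h | h
  · have := RelCWComplex.eq_of_not_disjoint_openCell (Set.not_disjoint_iff.2 ⟨q, hc, h⟩)
    simpa using this
  · exact absurd hc (Set.disjoint_left.1 (vertexSet_disjoint_openCell c) h)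

lemma interior_openCell_one (c : RelCWComplex.cell C 1) :
    interior (RelCWComplex.openCell 1 c) = ∅ := by
  have htarget : (RelCWComplex.map 1 c).target = RelCWComplex.openCell 1 c := by
    rw [RelCWComplex.openCell, ← RelCWComplex.source_eq 1 c, PartialEquiv.image_source_eq_target]
  refine interior_eq_empty_of_injOn (fun z => (RelCWComplex.map 1 c).symm z 0) ?_ ?_
  · have h := RelCWComplex.continuousOn_symm 1 c
    rw [htarget] at h
    exact (continuous_apply 0).comp_continuousOn h
  · intro z hz z' hz' h
    rw [← htarget] at hz hz'
    exact (RelCWComplex.map 1 c).symm.injOn hz hz' (funext fun i => by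
      rw [Subsingleton.elim i 0]; exact h)

/-- The two ends may be identified, so the open cell is treated through its inverse chart and the
endpoints are added as closed sets with empty interior. -/
lemma interior_closedCell_one (c : RelCWComplex.cell C 1) :
    interior (RelCWComplex.closedCell 1 c) = ∅ := by
  have h : RelCWComplex.closedCell 1 c = _ := DirEdge.support_eq (c, true)
  rw [h, Set.union_comm, interior_union_isClosed_of_interior_empty
    (Set.toFinite _).isClosed (interior_openCell_one c), ← Set.union_singleton,
    interior_union_isClosed_of_interior_empty isClosed_singleton (interior_singleton _),
    interior_singleton]

/-- With distinct ends the characteristic map is injective on the closed interval, so the closed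
cell is an arc and contractible. -/
lemma DirEdge.hasContinuousLogs_support {d : DirEdge C} (hd : d.source ≠ d.target) :
    HasContinuousLogs d.support := by
  obtain ⟨c, b⟩ := d
  have hne : RelCWComplex.map 1 c (1 : Fin 1 → ℝ) ≠ RelCWComplex.map 1 c (-1) := by
    have h1 : (fun _ => 1 : Fin 1 → ℝ) = 1 := rfl
    have h2 : (fun _ => -1 : Fin 1 → ℝ) = -1 := rfl
    cases b
    · norm_num [DirEdge.source, DirEdge.target, DirEdge.pt, h1, h2] at hd
      exact hd
    · norm_num [DirEdge.source, DirEdge.target, DirEdge.pt, h1, h2] at hd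
      exact fun h => hd h.symm
  have hsphere : ∀ x ∈ Metric.sphere (0 : Fin 1 → ℝ) 1, x = 1 ∨ x = -1 := fun x hx => by
    have hx0 : |x 0| = 1 := by
      simpa [Pi.norm_def] using hx
    rcases (abs_eq zero_le_one).1 hx0 with h | h
    · exact Or.inl (funext fun i => by rw [Subsingleton.elim i 0]; exact h)
    · exact Or.inr (funext fun i => by rw [Subsingleton.elim i 0]; exact h)
  have hball : Set.InjOn (RelCWComplex.map 1 c) (Metric.ball 0 1) :=
    RelCWComplex.source_eq 1 c ▸ (RelCWComplex.map 1 c).injOn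
  have hmix : ∀ x ∈ Metric.ball (0 : Fin 1 → ℝ) 1, ∀ y ∈ Metric.sphere (0 : Fin 1 → ℝ) 1,
      RelCWComplex.map 1 c x ≠ RelCWComplex.map 1 c y := fun x hx y hy h =>
    Set.disjoint_left.1 (vertexSet_disjoint_openCell c) (mem_vertexSet_of_sphere c hy)
      (h ▸ Set.mem_image_of_mem _ hx)
  have hinj : Function.Injective (Set.domRestrict (Metric.closedBall (0 : Fin 1 → ℝ) 1)
      (RelCWComplex.map 1 c)) := by
    rintro ⟨x, hx⟩ ⟨y, hy⟩ hxy
    simp only [Set.domRestrict_apply] at hxy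
    rw [← Metric.ball_union_sphere] at hx hy
    apply Subtype.ext
    rcases hx with hx | hx <;> rcases hy with hy | hy
    · exact hball hx hy hxy
    · exact absurd hxy (hmix x hx y hy)
    · exact absurd hxy.symm (hmix y hy x hx)
    · rcases hsphere x hx with rfl | rfl <;> rcases hsphere y hy with rfl | rfl
      · rfl
      · exact absurd hxy hne
      · exact absurd hxy.symm hne
      · rfl
  have hcont : Continuous (Set.domRestrict (Metric.closedBall (0 : Fin 1 → ℝ) 1)
      (RelCWComplex.map 1 c)) :=
    continuousOn_iff_continuous_domRestrict.1 (RelCWComplex.continuousOn 1 c)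
  have : ContractibleSpace (Metric.closedBall (0 : Fin 1 → ℝ) 1) :=
    Metric.contractibleSpace_closedBall zero_le_one
  have hrange : Set.range (Set.domRestrict (Metric.closedBall (0 : Fin 1 → ℝ) 1)
      (RelCWComplex.map 1 c)) = DirEdge.support (c, b) := by
    rw [Set.range_domRestrict]; rfl
  have := (hcont.isClosedEmbedding hinj).isEmbedding.toHomeomorph.symm.contractibleSpace
  exact hrange ▸ hasContinuousLogs_of_contractible

end Cells

/-! ### Edge paths -/

section Paths

variable {C : Set Plane} [CWComplex C]

/-- The directed edge with the opposite direction. -/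
def DirEdge.reverse (d : DirEdge C) : DirEdge C := (d.1, !d.2)

lemma DirEdge.reverse_reverse (d : DirEdge C) : d.reverse.reverse = d := by
  simp [DirEdge.reverse]

lemma DirEdge.source_reverse (d : DirEdge C) : d.reverse.source = d.target := by
  rcases d with ⟨c, _ | _⟩ <;>
    norm_num [DirEdge.reverse, DirEdge.source, DirEdge.target, DirEdge.pt]

lemma DirEdge.target_reverse (d : DirEdge C) : d.reverse.target = d.source := by
  rw [← d.reverse.source_reverse, d.reverse_reverse]

lemma DirEdge.eq_or_eq_reverse {d d' : DirEdge C} (h : d.1 = d'.1) : d = d' ∨ d = d'.reverse := by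
  rcases d with ⟨c, _ | _⟩ <;> rcases d' with ⟨c', _ | _⟩ <;> simp_all [DirEdge.reverse]

lemma isEdgePath_append {u v : Plane} {l m : List (DirEdge C)} :
    IsEdgePath u (l ++ m) v ↔ ∃ w, IsEdgePath u l w ∧ IsEdgePath w m v := by
  induction l generalizing u with
  | nil => simp [IsEdgePath]
  | cons d l ih => simp [IsEdgePath, ih, and_assoc]

lemma IsEdgePath.end_mem {u v : Plane} {l : List (DirEdge C)} (h : IsEdgePath u l v) :
    v ∈ u :: l.map DirEdge.target := by
  induction l generalizing u with
  | nil => exact List.mem_singleton.2 (Eq.symm h)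
  | cons d l ih => exact List.mem_cons_of_mem _ (ih h.2)

lemma IsEdgePath.end_mem_vertexSet {u v : Plane} {l : List (DirEdge C)} (h : IsEdgePath u l v)
    (hu : u ∈ vertexSet C) : v ∈ vertexSet C := by
  rcases List.mem_cons.1 h.end_mem with rfl | hv
  · exact hu
  · obtain ⟨d, -, rfl⟩ := List.mem_map.1 hv
    exact d.target_mem

lemma IsEdgePath.source_mem {u v : Plane} {l : List (DirEdge C)} (h : IsEdgePath u l v)
    {d : DirEdge C} (hd : d ∈ l) : d.source ∈ u :: l.map DirEdge.target := by
  induction l generalizing u with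
  | nil => simp at hd
  | cons d' l ih =>
    rcases List.mem_cons.1 hd with rfl | hd
    · simp [h.1]
    · exact List.mem_cons_of_mem _ (ih h.2 hd)

lemma IsEdgePath.endpoint_mem {u v w : Plane} {l : List (DirEdge C)} (h : IsEdgePath u l v)
    {d : DirEdge C} (hd : d ∈ l) (hw : w = d.source ∨ w = d.target) :
    w ∈ u :: l.map DirEdge.target := by
  rcases hw with rfl | rfl
  · exact h.source_mem hd
  · exact List.mem_cons_of_mem _ (List.mem_map_of_mem hd)

lemma IsEdgePath.exists_split {u v w : Plane} {l : List (DirEdge C)} (h : IsEdgePath u l v)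
    (hw : w ∈ u :: l.map DirEdge.target) :
    ∃ m n, l = m ++ n ∧ IsEdgePath u m w ∧ IsEdgePath w n v := by
  induction l generalizing u with
  | nil =>
    obtain rfl : w = u := by simpa using hw
    exact ⟨[], [], rfl, rfl, h⟩
  | cons d l ih =>
    rcases List.mem_cons.1 hw with rfl | hw
    · exact ⟨[], d :: l, rfl, rfl, h⟩
    · obtain ⟨m, n, rfl, hm, hn⟩ := ih h.2 hw
      exact ⟨d :: m, n, rfl, ⟨h.1, hm⟩, hn⟩

lemma IsEdgePath.reverse {u v : Plane} {l : List (DirEdge C)} (h : IsEdgePath u l v) :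
    IsEdgePath v (l.map DirEdge.reverse).reverse u := by
  induction l generalizing u with
  | nil => exact Eq.symm h
  | cons d l ih =>
    rw [List.map_cons, List.reverse_cons, isEdgePath_append]
    exact ⟨d.target, ih h.2, d.source_reverse, d.target_reverse.trans h.1⟩

/-! ### Reduced paths and uniqueness of simple paths in a tree. -/

variable {T : Set (RelCWComplex.cell C 1)}

lemma IsSimplePathIn.of_append {u v w : Plane} {l m : List (DirEdge C)}
    (h : IsSimplePathIn T u (l ++ m) v) (hl : IsEdgePath u l w) : IsSimplePathIn T u l w := by
  refine ⟨hl, fun d hd => h.2.1 d (List.mem_append_left _ hd), h.2.2.sublist ?_⟩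
  simp

lemma IsSimplePathIn.tail {u v : Plane} {d : DirEdge C} {l : List (DirEdge C)}
    (h : IsSimplePathIn T u (d :: l) v) : IsSimplePathIn T d.target l v :=
  ⟨h.1.2, fun d' hd' => h.2.1 d' (List.mem_cons_of_mem _ hd'), (List.nodup_cons.1 h.2.2).2⟩

lemma IsSimplePathIn.nodup_cells {u v : Plane} {l : List (DirEdge C)}
    (h : IsSimplePathIn T u l v) : (l.map Prod.fst).Nodup := by
  induction l generalizing u with
  | nil => simp
  | cons d l ih =>
    refine List.nodup_cons.2 ⟨fun hd => ?_, ih h.tail⟩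
    obtain ⟨d', hd', heq⟩ := List.mem_map.1 hd
    refine (List.nodup_cons.1 h.2.2).1 ?_
    rw [← h.1.1]
    refine h.1.2.endpoint_mem hd' ?_
    rcases DirEdge.eq_or_eq_reverse heq with rfl | rfl
    · exact Or.inl rfl
    · exact Or.inr d.target_reverse.symm

/-- No directed edge of the path is followed by its reverse. -/
def IsReducedPath (l : List (DirEdge C)) : Prop :=
  l.IsChain fun d d' => d' ≠ d.reverse

lemma IsSimplePathIn.isReducedPath {u v : Plane} {l : List (DirEdge C)}
    (h : IsSimplePathIn T u l v) : IsReducedPath l := by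
  induction l generalizing u with
  | nil => exact List.isChain_nil
  | cons d l ih =>
    refine List.isChain_cons.2 ⟨fun d' hd' heq => ?_, ih h.tail⟩
    refine (List.nodup_cons.1 h.2.2).1 ?_
    rw [← h.1.1, ← d.target_reverse, ← heq]
    exact List.mem_cons_of_mem _ (List.mem_map_of_mem (List.mem_of_mem_head? hd'))

lemma IsReducedPath.reverse {l : List (DirEdge C)} (h : IsReducedPath l) :
    IsReducedPath (l.map DirEdge.reverse).reverse := by
  rw [IsReducedPath, List.isChain_reverse, List.isChain_map]
  refine List.IsChain.imp (fun d d' hd heq => hd ?_) h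
  rw [heq, DirEdge.reverse_reverse]

/-- Inductively the path after its first edge is simple. If it returned to `u`, the segment up to
that return would form a simple circuit with the first edge. -/
lemma IsSpanningTree.isSimplePathIn_of_isReducedPath (hT : IsSpanningTree C T) {u v : Plane}
    {l : List (DirEdge C)} (h : IsEdgePath u l v) (hlT : ∀ d ∈ l, d.1 ∈ T)
    (hl : IsReducedPath l) : IsSimplePathIn T u l v := by
  induction l generalizing u with
  | nil => exact ⟨h, hlT, by simp⟩
  | cons d l ih =>
    have hs := ih h.2 (fun d' hd' => hlT d' (List.mem_cons_of_mem _ hd')) (List.isChain_cons.1 hl).2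
    refine ⟨h, hlT, List.nodup_cons.2 ⟨fun hu => ?_, hs.2.2⟩⟩
    obtain ⟨m, n, rfl, hm, -⟩ := hs.1.exists_split hu
    have hms := hs.of_append hm
    refine hT.acyclic u (d :: m) ⟨by simp, ⟨h.1, hm⟩,
      fun d' hd' => hlT d' (by simp only [List.mem_cons, List.mem_append] at hd' ⊢; tauto),
      List.nodup_cons.2 ⟨fun hd => ?_, hms.nodup_cells⟩, hms.2.2⟩
    obtain ⟨d', hd', heq⟩ := List.mem_map.1 hd
    -- A second use of the cell of `d` in the same direction revisits `d.target`. In the opposite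
    -- direction it either follows `d` at once, against reducedness, or starts at `d.target` later
    -- on.
    rcases DirEdge.eq_or_eq_reverse heq with rfl | rfl
    · exact (List.nodup_cons.1 hms.2.2).1 (List.mem_map_of_mem hd')
    · cases m with
      | nil => simp at hd'
      | cons a m =>
        rcases List.mem_cons.1 hd' with rfl | hd'
        · exact (List.isChain_cons_cons.1 hl).1 rfl
        · refine (List.nodup_cons.1 hms.2.2).1 ?_
          have := hms.1.2.source_mem hd'
          rwa [d.source_reverse] at this

lemma IsSimplePathIn.eq_nil {u : Plane} {l : List (DirEdge C)} (h : IsSimplePathIn T u l u) :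
    l = [] := by
  cases l with
  | nil => rfl
  | cons d l => exact absurd h.1.2.end_mem (List.nodup_cons.1 h.2.2).1

/-- Equal last edges are stripped by induction. If the last edges differ, `l` followed by the
reverse of `m` is reduced, hence simple, and being closed it is empty. -/
lemma IsSpanningTree.simplePath_unique (hT : IsSpanningTree C T) {u v : Plane}
    {l m : List (DirEdge C)} (hl : IsSimplePathIn T u l v) (hm : IsSimplePathIn T u m v) :
    l = m := by
  induction l using List.reverseRecOn generalizing m v with
  | nil =>
    obtain rfl : u = v := hl.1
    exact hm.eq_nil.symm
  | append_singleton a d ih =>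
    rcases List.eq_nil_or_concat' m with rfl | ⟨b, d', rfl⟩
    · obtain rfl : u = v := hm.1
      exact hl.eq_nil
    obtain ⟨w, ha, hd⟩ := isEdgePath_append.1 hl.1
    obtain ⟨w', hb, hd'⟩ := isEdgePath_append.1 hm.1
    by_cases heq : d = d'
    · subst heq
      obtain rfl : w = w' := hd.1.symm.trans hd'.1
      rw [ih (hl.of_append ha) (hm.of_append hb)]
    exfalso
    have hp := isEdgePath_append.2 ⟨v, hl.1, hm.1.reverse⟩
    have hred : IsReducedPath ((a ++ [d]) ++ ((b ++ [d']).map DirEdge.reverse).reverse) := by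
      refine List.isChain_append.2 ⟨hl.isReducedPath, hm.isReducedPath.reverse, ?_⟩
      intro x hx y hy
      simp only [List.getLast?_append, List.getLast?_singleton, Option.some_or, Option.mem_def,
        Option.some.injEq, List.map_append, List.map_cons, List.map_nil, List.reverse_append,
        List.reverse_cons, List.reverse_nil, List.nil_append, List.singleton_append,
        List.head?_cons] at hx hy
      subst hx hy
      intro h
      exact heq (by rw [← d.reverse_reverse, ← h, DirEdge.reverse_reverse])
    have hs := hT.isSimplePathIn_of_isReducedPath hp (fun c hc => ?_) hred
    · simpa using hs.eq_nil
    · rcases List.mem_append.1 hc with hc | hc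
      · exact hl.2.1 c hc
      · obtain ⟨c', hc', rfl⟩ := List.mem_map.1 (List.mem_reverse.1 hc)
        exact hm.2.1 c' hc'

lemma IsSpanningTree.source_ne_target (hT : IsSpanningTree C T) {d : DirEdge C} (hd : d.1 ∈ T) :
    d.source ≠ d.target := fun h =>
  hT.acyclic d.source [d] ⟨by simp, ⟨rfl, h.symm⟩, by simpa using hd, by simp, by simp⟩

/-- A vertex on a tree path determines an initial segment of it. -/
lemma IsSpanningTree.prefix_of_mem (hT : IsSpanningTree C T) {u v w : Plane}
    {l m : List (DirEdge C)} (hl : IsSimplePathIn T u l v) (hm : IsSimplePathIn T u m w)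
    (hw : w ∈ u :: l.map DirEdge.target) : m <+: l := by
  obtain ⟨a, b, rfl, ha, -⟩ := hl.1.exists_split hw
  exact ⟨b, by rw [hT.simplePath_unique hm (hl.of_append ha)]⟩

/-! ### Supports of edge paths -/

lemma pathSupport_nil : pathSupport ([] : List (DirEdge C)) = ∅ := by simp [pathSupport]

lemma pathSupport_cons (d : DirEdge C) (l : List (DirEdge C)) :
    pathSupport (d :: l) = d.support ∪ pathSupport l := by simp [pathSupport, Set.iUnion_or,
      Set.iUnion_union_distrib]

lemma mem_pathSupport {l : List (DirEdge C)} {q : Plane} :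
    q ∈ pathSupport l ↔ ∃ d ∈ l, q ∈ d.support := by simp [pathSupport]

lemma pathSupport_append (l m : List (DirEdge C)) :
    pathSupport (l ++ m) = pathSupport l ∪ pathSupport m := by
  ext q; simp only [mem_pathSupport, List.mem_append, Set.mem_union, or_and_right, exists_or]

lemma DirEdge.support_subset_pathSupport {d : DirEdge C} {l : List (DirEdge C)} (h : d ∈ l) :
    d.support ⊆ pathSupport l := fun _ hq => mem_pathSupport.2 ⟨d, h, hq⟩

lemma pathSupport_mono {l m : List (DirEdge C)} (h : l ⊆ m) : pathSupport l ⊆ pathSupport m :=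
  fun q hq => by
    obtain ⟨d, hd, hq⟩ := mem_pathSupport.1 hq
    exact mem_pathSupport.2 ⟨d, h hd, hq⟩

lemma isClosed_pathSupport (l : List (DirEdge C)) : IsClosed (pathSupport l) := by
  induction l with
  | nil => simp [pathSupport_nil]
  | cons d l ih => exact pathSupport_cons d l ▸ (isClosed_closedCell_one d.1).union ih

lemma IsEdgePath.vertex_mem_support {u v w : Plane} {l : List (DirEdge C)} (_ : IsEdgePath u l v)
    (hw : w ∈ u :: l.map DirEdge.target) : w ∈ {u} ∪ pathSupport l := by
  rcases List.mem_cons.1 hw with rfl | hw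
  · exact Or.inl rfl
  · obtain ⟨d, hd, rfl⟩ := List.mem_map.1 hw
    exact Or.inr (d.support_subset_pathSupport hd d.target_mem_support)

lemma IsEdgePath.mem_of_mem_support {u v w : Plane} {l : List (DirEdge C)} (h : IsEdgePath u l v)
    (hwv : w ∈ vertexSet C) (hw : w ∈ {u} ∪ pathSupport l) : w ∈ u :: l.map DirEdge.target := by
  rcases hw with rfl | hw
  · simp
  · obtain ⟨d, hd, hq⟩ := mem_pathSupport.1 hw
    exact h.endpoint_mem hd (DirEdge.eq_source_or_target hwv hq)

lemma IsEdgePath.support_cons {u v : Plane} {d : DirEdge C} {l : List (DirEdge C)}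
    (h : IsEdgePath u (d :: l) v) :
    {u} ∪ pathSupport (d :: l) = d.support ∪ ({d.target} ∪ pathSupport l) := by
  have hs := d.source_mem_support
  have ht := d.target_mem_support
  rw [h.1] at hs
  rw [pathSupport_cons]
  ext q
  simp only [Set.mem_union, Set.mem_singleton_iff]
  constructor
  · rintro (rfl | h | h) <;> tauto
  · rintro (h | rfl | h) <;> tauto

lemma IsEdgePath.isPreconnected_support {u v : Plane} {l : List (DirEdge C)}
    (h : IsEdgePath u l v) : IsPreconnected ({u} ∪ pathSupport l) := by
  induction l generalizing u with
  | nil => simpa [pathSupport_nil] using isPreconnected_singleton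
  | cons d l ih =>
    rw [h.support_cons]
    exact (isPreconnected_closedCell_one d.1).union d.target d.target_mem_support (Or.inl rfl)
      (ih h.2)

/-- The path is glued from arcs, each meeting the rest of the path only in `d.target`: another
common point would repeat a 1-cell or revisit `d.source`. -/
lemma IsSpanningTree.hasContinuousLogs_support (hT : IsSpanningTree C T) {u v : Plane}
    {l : List (DirEdge C)} (h : IsSimplePathIn T u l v) :
    HasContinuousLogs ({u} ∪ pathSupport l) := by
  induction l generalizing u with
  | nil => simpa [pathSupport_nil] using hasContinuousLogs_of_contractible
  | cons d l ih =>
    rw [h.1.support_cons]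
    refine HasContinuousLogs.union
      (d.hasContinuousLogs_support (hT.source_ne_target (h.2.1 d (by simp)))) (ih h.tail)
      (isClosed_closedCell_one d.1) (isClosed_singleton.union (isClosed_pathSupport l)) ?_
    convert isPreconnected_singleton (x := d.target) using 1
    refine Set.Subset.antisymm (fun q hq => ?_) (by
      rintro _ rfl; exact ⟨d.target_mem_support, Or.inl rfl⟩)
    have hnot := (List.nodup_cons.1 h.2.2).1
    rcases d.mem_openCell_or_vertexSet hq.1 with ho | hv
    · rcases hq.2 with rfl | hl
      · rfl
      obtain ⟨d', hd', hqd'⟩ := mem_pathSupport.1 hl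
      have hc := eq_of_mem_openCell_of_mem_support ho hqd'
      have := List.nodup_cons.1 h.nodup_cells
      exact absurd (List.mem_map.2 ⟨d', hd', hc.symm⟩) this.1
    · rcases DirEdge.eq_source_or_target hv hq.1 with rfl | rfl
      · exact absurd (h.1.1 ▸ h.1.2.mem_of_mem_support hv hq.2) hnot
      · rfl

/-! ### Longest common initial segments -/

lemma commonPrefix_prefix_left {α : Type*} (l m : List α) : commonPrefix l m <+: l := by
  induction l generalizing m with
  | nil => simp [commonPrefix]
  | cons a l ih =>
    cases m with
    | nil => simp [commonPrefix]
    | cons b m =>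
      rw [commonPrefix]
      split_ifs with h
      · exact (List.prefix_cons_inj a).2 (ih m)
      · exact List.nil_prefix

lemma commonPrefix_comm {α : Type*} (l m : List α) : commonPrefix l m = commonPrefix m l := by
  induction l generalizing m with
  | nil => cases m <;> simp [commonPrefix]
  | cons a l ih =>
    cases m with
    | nil => simp [commonPrefix]
    | cons b m =>
      rw [commonPrefix, commonPrefix]
      by_cases h : a = b
      · rw [if_pos h, if_pos h.symm, ih, h]
      · rw [if_neg h, if_neg (Ne.symm h)]

lemma commonPrefix_prefix_right {α : Type*} (l m : List α) : commonPrefix l m <+: m :=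
  commonPrefix_comm l m ▸ commonPrefix_prefix_left m l

lemma prefix_commonPrefix {α : Type*} {k l m : List α} (hl : k <+: l) (hm : k <+: m) :
    k <+: commonPrefix l m := by
  induction k generalizing l m with
  | nil => exact List.nil_prefix
  | cons a k ih =>
    obtain ⟨l, rfl⟩ := hl
    obtain ⟨m, rfl⟩ := hm
    simp only [List.cons_append, commonPrefix, if_true]
    exact (List.prefix_cons_inj a).2 (ih (List.prefix_append _ _) (List.prefix_append _ _))

/-- Two tree paths from `u` meet exactly in their common initial segment, which is connected. -/
lemma IsSpanningTree.hasContinuousLogs_union (hT : IsSpanningTree C T) {u v w : Plane}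
    {l m : List (DirEdge C)} (hl : IsSimplePathIn T u l v) (hm : IsSimplePathIn T u m w)
    (hu : u ∈ vertexSet C) :
    HasContinuousLogs (({u} ∪ pathSupport l) ∪ ({u} ∪ pathSupport m)) := by
  refine (hT.hasContinuousLogs_support hl).union (hT.hasContinuousLogs_support hm)
    (isClosed_singleton.union (isClosed_pathSupport l))
    (isClosed_singleton.union (isClosed_pathSupport m)) ?_
  obtain ⟨b, hb⟩ := commonPrefix_prefix_left l m
  obtain ⟨t, ht, -⟩ := isEdgePath_append.1 (hb.symm ▸ hl.1)
  convert ht.isPreconnected_support using 1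
  refine Set.Subset.antisymm (fun q hq => ?_) fun q hq => ?_
  · have hvert : ∀ z ∈ vertexSet C, z ∈ u :: l.map DirEdge.target → z ∈ u :: m.map DirEdge.target →
        ∃ k, IsSimplePathIn T u k z ∧ k <+: commonPrefix l m := fun z hz h h' => by
      obtain ⟨k, hk⟩ := hT.exists_simplePath hu hz
      exact ⟨k, hk, prefix_commonPrefix (hT.prefix_of_mem hl hk h) (hT.prefix_of_mem hm hk h')⟩
    by_cases hqv : q ∈ vertexSet C
    · obtain ⟨k, hk, hkp⟩ := hvert q hqv (hl.1.mem_of_mem_support hqv hq.1)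
        (hm.1.mem_of_mem_support hqv hq.2)
      exact Set.union_subset_union_right _ (pathSupport_mono hkp.subset)
        (hk.1.vertex_mem_support hk.1.end_mem)
    -- Off the vertices, `q` lies in a 1-cell used by both paths, so `d.target` is a common vertex.
    -- The tree path to it ends with `d`, which puts `d` in the common segment.
    · have hne : q ≠ u := fun h => hqv (h ▸ hu)
      obtain ⟨d, hd, hqd⟩ := mem_pathSupport.1 (hq.1.resolve_left hne)
      obtain ⟨d', hd', hqd'⟩ := mem_pathSupport.1 (hq.2.resolve_left hne)
      have ho := (d.mem_openCell_or_vertexSet hqd).resolve_right hqv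
      have hc := eq_of_mem_openCell_of_mem_support ho hqd'
      have htgt : d.target ∈ u :: m.map DirEdge.target := by
        refine hm.1.endpoint_mem hd' ?_
        rcases DirEdge.eq_or_eq_reverse hc with rfl | rfl
        · exact Or.inr rfl
        · exact Or.inl d'.target_reverse
      obtain ⟨k, hk, hkp⟩ := hvert d.target d.target_mem
        (List.mem_cons_of_mem _ (List.mem_map_of_mem hd)) htgt
      obtain ⟨a, c, rfl⟩ := List.append_of_mem hd
      obtain ⟨z, ha, hz⟩ := isEdgePath_append.1 hl.1
      have hpre : IsSimplePathIn T u (a ++ [d]) d.target :=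
        IsSimplePathIn.of_append (m := c) (v := v) (by simpa using hl)
          (isEdgePath_append.2 ⟨z, ha, hz.1, rfl⟩)
      rw [hT.simplePath_unique hk hpre] at hkp
      exact Or.inr (d.support_subset_pathSupport (hkp.subset (by simp)) hqd)
  · exact ⟨Set.union_subset_union_right _
      (pathSupport_mono (commonPrefix_prefix_left l m).subset) hq,
      Set.union_subset_union_right _
      (pathSupport_mono (commonPrefix_prefix_right l m).subset) hq⟩

end Paths

/-! ### Icicles -/

namespace VanKampenDiagram

variable {A : Type*} {R : Set (List (A × Bool))} {Δ : VanKampenDiagram R}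
  {T : Set Δ.Edge} (hT : IsSpanningTree Δ.carrier T) (e : Δ.Edge)

lemma gammaX_spec :
    IsSimplePathIn T Δ.base (gammaX hT e) (DirEdge.source (C := Δ.carrier) (e, true)) :=
  (hT.exists_simplePath Δ.base_mem_vertexSet (DirEdge.source_mem (e, true))).choose_spec

lemma gammaY_spec :
    IsSimplePathIn T Δ.base (gammaY hT e) (DirEdge.target (C := Δ.carrier) (e, true)) :=
  (hT.exists_simplePath Δ.base_mem_vertexSet (DirEdge.target_mem (e, true))).choose_spec

lemma alpha_append_betaX : alpha hT e ++ betaX hT e = gammaX hT e :=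
  List.prefix_iff_eq_append.1 (commonPrefix_prefix_left _ _)

lemma alpha_append_betaY : alpha hT e ++ betaY hT e = gammaY hT e :=
  List.prefix_iff_eq_append.1 (commonPrefix_prefix_right _ _)

lemma isClosed_eta : IsClosed (eta hT e) :=
  ((isClosed_pathSupport _).union (isClosed_closedCell_one e)).union (isClosed_pathSupport _)

lemma isClosed_body : IsClosed (body hT e) := isClosed_union_inside (isClosed_eta hT e)

lemma isClosed_carrier (Δ : VanKampenDiagram R) : IsClosed Δ.carrier := RelCWComplex.isClosed

lemma edgeSet_subset_eta : Δ.edgeSet e ⊆ eta hT e := fun _ h => Or.inl (Or.inr h)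

lemma pathSupport_betaX_subset_eta : pathSupport (betaX hT e) ⊆ eta hT e :=
  fun _ h => Or.inl (Or.inl h)

lemma pathSupport_betaY_subset_eta : pathSupport (betaY hT e) ⊆ eta hT e := fun _ h => Or.inr h

/-- The circuit of `e` is a union of closed 1-cells. -/
lemma mem_eta_iff {q : Plane} : q ∈ eta hT e ↔
    ∃ d : DirEdge Δ.carrier, (d ∈ betaX hT e ∨ d.1 = e ∨ d ∈ betaY hT e) ∧ q ∈ d.support := by
  simp only [eta, Set.mem_union, mem_pathSupport]
  constructor
  · rintro ((⟨d, hd, hq⟩ | hq) | ⟨d, hd, hq⟩)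
    · exact ⟨d, Or.inl hd, hq⟩
    · exact ⟨(e, true), Or.inr (Or.inl rfl), hq⟩
    · exact ⟨d, Or.inr (Or.inr hd), hq⟩
  · rintro ⟨d, hd | rfl | hd, hq⟩
    · exact Or.inl (Or.inl ⟨d, hd, hq⟩)
    · exact Or.inl (Or.inr hq)
    · exact Or.inr ⟨d, hd, hq⟩

lemma eta_subset_carrier : eta hT e ⊆ Δ.carrier := fun q hq => by
  obtain ⟨d, -, hq⟩ := (mem_eta_iff hT e).1 hq
  exact RelCWComplex.closedCell_subset_complex 1 d.1 hq

/-- The basepoint is not inside the circuit of `e`, because a contractible compact subset of the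
plane has no bounded complementary component. -/
lemma base_notMem_inside : Δ.base ∉ inside (eta hT e) := fun h => by
  have := Δ.contractible
  have hsub : inside (eta hT e) ⊆ Δ.carrier :=
    hasContinuousLogs_of_contractible.inside_subset Δ.isClosed_carrier (isClosed_eta hT e)
      (eta_subset_carrier hT e)
  exact Δ.base_mem_frontier.2
    (interior_maximal hsub (isOpen_inside (isClosed_eta hT e)) h)

lemma disjoint_openCell_eta {c : Δ.Edge} (hc : ¬ Δ.edgeSet c ⊆ eta hT e) :
    Disjoint (RelCWComplex.openCell 1 c) (eta hT e) := by
  refine Set.disjoint_left.2 fun q hq hqe => hc ?_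
  obtain ⟨d, hd, hqd⟩ := (mem_eta_iff hT e).1 hqe
  obtain rfl := eq_of_mem_openCell_of_mem_support hq hqd
  exact fun z hz => (mem_eta_iff hT e).2 ⟨d, hd, hz⟩

/-- A closed 1-cell that meets the inside of the circuit of `e` lies in the body of the icicle. -/
lemma edgeSet_subset_body {c : Δ.Edge} (h : (Δ.edgeSet c ∩ inside (eta hT e)).Nonempty) :
    Δ.edgeSet c ⊆ body hT e := by
  obtain ⟨q, hqc, hq⟩ := h
  have hopen : (RelCWComplex.openCell 1 c ∩ inside (eta hT e)).Nonempty := by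
    rw [edgeSet, ← closure_openCell_one] at hqc
    rw [Set.inter_comm]
    exact mem_closure_iff.1 hqc _ (isOpen_inside (isClosed_eta hT e)) hq
  have hdisj := disjoint_openCell_eta hT e (c := c) fun hc => hq.1 (hc hqc)
  rw [edgeSet, ← closure_openCell_one]
  refine closure_minimal (fun z hz => Or.inr ?_) (isClosed_body hT e)
  exact (isPreconnected_openCell_one c).subset_inside hdisj hopen hz

/-- The tree path to a vertex of the circuit of `e` runs along `α` and then along the circuit. -/
lemma exists_path_of_mem_eta {w : Plane} (hwv : w ∈ vertexSet Δ.carrier) (hw : w ∈ eta hT e) :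
    ∃ s, IsSimplePathIn T Δ.base (alpha hT e ++ s) w ∧ pathSupport s ⊆ eta hT e := by
  have key : ∀ (γ β : List (DirEdge Δ.carrier)) (v : Plane), alpha hT e ++ β = γ →
      IsSimplePathIn T Δ.base γ v → pathSupport β ⊆ eta hT e → w ∈ pathSupport β →
      ∃ s, IsSimplePathIn T Δ.base (alpha hT e ++ s) w ∧ pathSupport s ⊆ eta hT e := by
    rintro _ β v rfl hγ hβ hwβ
    obtain ⟨t, hα, hβp⟩ := isEdgePath_append.1 hγ.1
    obtain ⟨m, n, rfl, hm, -⟩ := hβp.exists_split (hβp.mem_of_mem_support hwv (Or.inr hwβ))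
    refine ⟨m, IsSimplePathIn.of_append (m := n) (v := v) (by simpa using hγ)
      (isEdgePath_append.2 ⟨t, hα, hm⟩), ?_⟩
    exact (pathSupport_mono (List.subset_append_left _ _)).trans hβ
  rcases hw with (hw | hw) | hw
  · exact key _ _ _ (alpha_append_betaX hT e) (gammaX_spec hT e)
      (pathSupport_betaX_subset_eta hT e) hw
  · rcases DirEdge.eq_source_or_target (d := (e, true)) hwv hw with rfl | rfl
    · exact ⟨_, (alpha_append_betaX hT e).symm ▸ gammaX_spec hT e,
        pathSupport_betaX_subset_eta hT e⟩
    · exact ⟨_, (alpha_append_betaY hT e).symm ▸ gammaY_spec hT e,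
        pathSupport_betaY_subset_eta hT e⟩
  · exact key _ _ _ (alpha_append_betaY hT e) (gammaY_spec hT e)
      (pathSupport_betaY_subset_eta hT e) hw

/-- An edge path that ends in the body of the icicle either stays in the body after some visit to
the circuit, or starts inside the circuit and stays in the body. -/
lemma exists_last_visit {u v : Plane} {l : List (DirEdge Δ.carrier)} (h : IsEdgePath u l v)
    (hv : v ∈ body hT e) :
    (∃ m n w, l = m ++ n ∧ IsEdgePath u m w ∧ w ∈ eta hT e ∧
      pathSupport n ⊆ body hT e) ∨
      (u ∈ inside (eta hT e) ∧ pathSupport l ⊆ body hT e) := by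
  induction l generalizing u with
  | nil =>
    obtain rfl : u = v := h
    rcases hv with hv | hv
    · exact Or.inl ⟨[], [], u, rfl, rfl, hv, by simp [pathSupport_nil]⟩
    · exact Or.inr ⟨hv, by simp [pathSupport_nil]⟩
  | cons d l ih =>
    rcases ih h.2 with ⟨m, n, w, rfl, hm, hw, hn⟩ | ⟨ht, hl⟩
    · exact Or.inl ⟨d :: m, n, w, rfl, ⟨h.1, hm⟩, hw, hn⟩
    · have hd : d.support ⊆ body hT e :=
        edgeSet_subset_body hT e (c := d.1) ⟨_, d.target_mem_support, ht⟩
      have hs : pathSupport (d :: l) ⊆ body hT e := by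
        rw [pathSupport_cons]; exact Set.union_subset hd hl
      rcases h.1 ▸ hd d.source_mem_support with hu | hu
      · exact Or.inl ⟨[], d :: l, u, rfl, rfl, hu, hs⟩
      · exact Or.inr ⟨hu, hs⟩

/-- The tree path to a vertex of the body runs along `α` and then through the body. -/
lemma exists_eq_append_of_mem_body {v : Plane} {l : List (DirEdge Δ.carrier)}
    (hl : IsSimplePathIn T Δ.base l v) (hv : v ∈ body hT e) :
    ∃ s, l = alpha hT e ++ s ∧ pathSupport s ⊆ body hT e := by
  -- The basepoint is not inside `η`, so the path has a visit to `η` after which it stays in the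
  -- body.
  rcases exists_last_visit hT e hl.1 hv with ⟨m, n, w, rfl, hm, hw, hn⟩ | ⟨h, -⟩
  · obtain ⟨s, hs, hse⟩ :=
      exists_path_of_mem_eta hT e (hm.end_mem_vertexSet Δ.base_mem_vertexSet) hw
    rw [hT.simplePath_unique (hl.of_append hm) hs]
    refine ⟨s ++ n, List.append_assoc _ _ _, ?_⟩
    rw [pathSupport_append]
    exact Set.union_subset (hse.trans Set.subset_union_left) hn
  · exact absurd h (base_notMem_inside hT e)

/-- An edge that starts inside `η` lies in the body, so it also ends inside unless it ends on `η`.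
-/
lemma mem_inside_of_path {w z : Plane} {l : List (DirEdge Δ.carrier)} (h : IsEdgePath w l z)
    (hw : w ∈ inside (eta hT e)) (hl : ∀ v ∈ l.map DirEdge.target, v ∉ eta hT e) :
    z ∈ inside (eta hT e) := by
  induction l generalizing w with
  | nil => exact (show w = z from h) ▸ hw
  | cons d l ih =>
    refine ih h.2 ?_ fun v hv => hl v (List.mem_cons_of_mem _ hv)
    have hd : d.support ⊆ body hT e :=
      edgeSet_subset_body hT e (c := d.1) ⟨_, d.source_mem_support, h.1.symm ▸ hw⟩
    exact (hd d.target_mem_support).resolve_left (hl _ (by simp))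

/-- A tree path from the basepoint that uses a 1-cell meeting the inside of the circuit of `e`
ends inside that circuit. -/
lemma end_mem_inside {z : Plane} {l : List (DirEdge Δ.carrier)}
    (hl : IsSimplePathIn T Δ.base l z) {d : DirEdge Δ.carrier} (hd : d ∈ l)
    (hdU : (d.support ∩ inside (eta hT e)).Nonempty) : z ∈ inside (eta hT e) := by
  obtain ⟨a, b, rfl⟩ := List.append_of_mem hd
  have hdb : d.support ⊆ body hT e := edgeSet_subset_body hT e (c := d.1) hdU
  obtain ⟨t, ha, hdt, hb⟩ := isEdgePath_append.1 hl.1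
  subst hdt
  -- Were `w` on `η`, the path up to `w` would be `α` followed by edges of `η`. Since `d.source` is
  -- in the body, `α` is already complete before `d`, so `d` would lie on `η`.
  have hno : ∀ w ∈ d.target :: b.map DirEdge.target, w ∉ eta hT e := by
    intro w hw hwe
    obtain ⟨m, n, rfl, hm, -⟩ := hb.exists_split hw
    have hp : IsSimplePathIn T Δ.base (a ++ d :: m) w :=
      IsSimplePathIn.of_append (m := n) (v := z) (by simpa using hl)
        (isEdgePath_append.2 ⟨_, ha, rfl, hm⟩)
    obtain ⟨s, hs, hse⟩ :=
      exists_path_of_mem_eta hT e (hm.end_mem_vertexSet d.target_mem) hwe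
    obtain ⟨s', hs', -⟩ := exists_eq_append_of_mem_body hT e (hl.of_append ha)
      (hdb d.source_mem_support)
    have heq := hT.simplePath_unique hp hs
    rw [hs', List.append_assoc] at heq
    have hds : d ∈ s := by
      rw [← List.append_cancel_left heq]; simp
    obtain ⟨q, hqd, hq⟩ := hdU
    exact hq.1 (hse (d.support_subset_pathSupport hds hqd))
  refine mem_inside_of_path hT e hb
    ((hdb d.target_mem_support).resolve_left (hno _ (by simp))) fun v hv => hno v ?_
  exact List.mem_cons_of_mem _ hv

/-! ### Nesting and disjointness of icicles. -/

variable {e} {e' : Δ.Edge}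

/-- The 1-cells of `α` lie in `T`, so the open cell of `e'` misses the tail; the body is closed and
takes in its closure. -/
lemma edgeSet_subset_body_of_subset_icicle (he' : e' ∉ T)
    (h : Δ.edgeSet e' ⊆ icicle hT e) : Δ.edgeSet e' ⊆ body hT e := by
  rw [edgeSet, ← closure_openCell_one]
  refine closure_minimal (fun q hq => ?_) (isClosed_body hT e)
  rcases h (RelCWComplex.openCell_subset_closedCell 1 e' hq) with (hq' | hq') | hq'
  · refine absurd hq (Set.disjoint_left.1 (vertexSet_disjoint_openCell e') ?_)
    rw [show q = Δ.base from hq']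
    exact Δ.base_mem_vertexSet
  · obtain ⟨d, hd, hqd⟩ := mem_pathSupport.1 hq'
    obtain rfl := eq_of_mem_openCell_of_mem_support hq hqd
    refine absurd ((gammaX_spec hT e).2.1 d ?_) he'
    rw [← alpha_append_betaX]
    exact List.mem_append_left _ hd
  · exact hq'

lemma icicle_subset_icicle (he' : e' ∉ T) (h : Δ.edgeSet e' ⊆ icicle hT e) :
    icicle hT e' ⊆ icicle hT e := by
  have hb := edgeSet_subset_body_of_subset_icicle hT he' h
  obtain ⟨s, hs, hsb⟩ := exists_eq_append_of_mem_body hT e (gammaX_spec hT e')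
    (hb (DirEdge.source_mem_support (C := Δ.carrier) (e', true)))
  obtain ⟨t, ht, htb⟩ := exists_eq_append_of_mem_body hT e (gammaY_spec hT e')
    (hb (DirEdge.target_mem_support (C := Δ.carrier) (e', true)))
  -- Both tree paths to the ends of `e'` begin with `α`. The piece `k` by which the tail of `e'` is
  -- longer lies in the body of `e`.
  obtain ⟨k, hk⟩ : alpha hT e <+: alpha hT e' :=
    prefix_commonPrefix ⟨s, hs.symm⟩ ⟨t, ht.symm⟩
  have hks : k ++ betaX hT e' = s := by
    have := alpha_append_betaX hT e'
    rw [hs, ← hk, List.append_assoc] at this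
    exact List.append_cancel_left this
  have hkt : k ++ betaY hT e' = t := by
    have := alpha_append_betaY hT e'
    rw [ht, ← hk, List.append_assoc] at this
    exact List.append_cancel_left this
  rw [← hks, pathSupport_append, Set.union_subset_iff] at hsb
  rw [← hkt, pathSupport_append, Set.union_subset_iff] at htb
  have hη : eta hT e' ⊆ body hT e := Set.union_subset (Set.union_subset hsb.2 hb) htb.2
  refine Set.union_subset ?_ (Set.union_subset ?_ ?_)
  · rw [tail, ← hk, pathSupport_append, ← Set.union_assoc]
    exact Set.union_subset_union_right _ hsb.1
  · exact hη.trans Set.subset_union_right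
  · exact (inside_subset_of_subset hη).trans Set.subset_union_right

/-- If a tree edge of the circuit of `e'` met the inside, the tree path through it would end inside,
at an end of `e'`, and `e'` would lie in the icicle. -/
lemma disjoint_eta_inside (h : ¬ Δ.edgeSet e' ⊆ icicle hT e) :
    Disjoint (eta hT e') (inside (eta hT e)) := by
  have hno : ∀ q ∈ Δ.edgeSet e', q ∉ inside (eta hT e) := fun q hq hqU =>
    h ((edgeSet_subset_body hT e ⟨q, hq, hqU⟩).trans Set.subset_union_right)
  refine Set.disjoint_left.2 fun q hq hqU => ?_
  obtain ⟨d, hd | rfl | hd, hqd⟩ := (mem_eta_iff hT e').1 hq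
  · refine hno _ (DirEdge.source_mem_support (C := Δ.carrier) (e', true))
      (end_mem_inside hT e (gammaX_spec hT e') (d := d) ?_ ⟨q, hqd, hqU⟩)
    rw [← alpha_append_betaX]
    exact List.mem_append_right _ hd
  · exact hno q hqd hqU
  · refine hno _ (DirEdge.target_mem_support (C := Δ.carrier) (e', true))
      (end_mem_inside hT e (gammaY_spec hT e') (d := d) ?_ ⟨q, hqd, hqU⟩)
    rw [← alpha_append_betaY]
    exact List.mem_append_right _ hd

/-- The part of the 1-skeleton that contains the basepoint and all 1-cells. -/
def skeleton (Δ : VanKampenDiagram R) : Set Plane := {Δ.base} ∪ ⋃ c : Δ.Edge, Δ.edgeSet c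

lemma pathSupport_subset_skeleton (l : List (DirEdge Δ.carrier)) : pathSupport l ⊆ Δ.skeleton :=
  fun _ hq => by
    obtain ⟨d, -, hqd⟩ := mem_pathSupport.1 hq
    exact Or.inr (Set.mem_iUnion.2 ⟨d.1, hqd⟩)

lemma interior_skeleton (Δ : VanKampenDiagram R) : interior Δ.skeleton = ∅ := by
  have := Δ.finite
  have : Finite (Σ n, RelCWComplex.cell Δ.carrier n) := RelCWComplex.finite_cells_of_finite
  have hfin : Finite Δ.Edge := Finite.of_injective (fun c : Δ.Edge =>
    (⟨1, c⟩ : Σ n, RelCWComplex.cell Δ.carrier n)) fun a b h => by simpa using h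
  have hs : ∀ s : Set Δ.Edge, s.Finite → interior (⋃ c ∈ s, Δ.edgeSet c) = ∅ := by
    intro s hs
    induction s, hs using Set.Finite.induction_on with
    | empty => simp
    | @insert c s _ _ ih =>
      rw [Set.biUnion_insert]
      exact (interior_union_isClosed_of_interior_empty (isClosed_closedCell_one c) ih).trans <|
        interior_closedCell_one c
  have h := hs Set.univ Set.finite_univ
  simp only [Set.mem_univ, Set.iUnion_true] at h
  rw [skeleton, interior_union_isClosed_of_interior_empty isClosed_singleton h]
  exact interior_singleton _

lemma mem_inside_of_mem_icicle {p : Plane} (hp : p ∈ icicle hT e) (hps : p ∉ Δ.skeleton) :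
    p ∈ inside (eta hT e) := by
  rcases hp with (hp | hp) | hp | hp
  · exact absurd (Or.inl hp) hps
  · exact absurd (pathSupport_subset_skeleton _ hp) hps
  · obtain ⟨d, -, hq⟩ := (mem_eta_iff hT e).1 hp
    exact absurd (Or.inr (Set.mem_iUnion.2 ⟨d.1, hq⟩)) hps
  · exact hp

/-- The other circuit consists of tree cells and `e'`, so it misses the open cell of `e`. What
remains is enlarged to full tree paths because their union has continuous logarithms. -/
lemma eta_inter_eta_subset (he : e ∉ T) (hne : e ≠ e') : eta hT e ∩ eta hT e' ⊆
    ({Δ.base} ∪ pathSupport (gammaX hT e)) ∪ ({Δ.base} ∪ pathSupport (gammaY hT e)) := by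
  rintro q ⟨(hq | hq) | hq, hq'⟩
  · refine Or.inl (Or.inr (pathSupport_mono ?_ hq))
    rw [← alpha_append_betaX]
    exact List.subset_append_right _ _
  · rcases DirEdge.mem_openCell_or_vertexSet (d := (e, true)) hq with ho | hv
    · obtain ⟨d, hd, hqd⟩ := (mem_eta_iff hT e').1 hq'
      obtain rfl := eq_of_mem_openCell_of_mem_support ho hqd
      rcases hd with hd | hd | hd
      · refine absurd ((gammaX_spec hT e').2.1 d ?_) he
        rw [← alpha_append_betaX]
        exact List.mem_append_right _ hd
      · exact absurd hd hne
      · refine absurd ((gammaY_spec hT e').2.1 d ?_) he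
        rw [← alpha_append_betaY]
        exact List.mem_append_right _ hd
    · rcases DirEdge.eq_source_or_target (d := (e, true)) hv hq with rfl | rfl
      · exact Or.inl ((gammaX_spec hT e).1.vertex_mem_support (gammaX_spec hT e).1.end_mem)
      · exact Or.inr ((gammaY_spec hT e).1.vertex_mem_support (gammaY_spec hT e).1.end_mem)
  · refine Or.inr (Or.inr (pathSupport_mono ?_ hq))
    rw [← alpha_append_betaY]
    exact List.subset_append_right _ _

lemma interior_icicle_inter_interior_icicle (he : e ∉ T)
    (h : ¬ Δ.edgeSet e' ⊆ icicle hT e) (h' : ¬ Δ.edgeSet e ⊆ icicle hT e') :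
    interior (icicle hT e) ∩ interior (icicle hT e') = ∅ := by
  -- It suffices that the two icicles meet only in the skeleton.
  rw [← interior_inter, ← Set.subset_empty_iff, ← Δ.interior_skeleton]
  refine interior_mono fun p hp => ?_
  by_contra hps
  have hne : e ≠ e' := by
    rintro rfl
    exact h ((edgeSet_subset_eta hT e).trans
      (Set.subset_union_left.trans Set.subset_union_right))
  have hlogs := hT.hasContinuousLogs_union (gammaX_spec hT e) (gammaY_spec hT e)
    Δ.base_mem_vertexSet
  have hsub := hlogs.inside_inter_inside_subset
    ((isClosed_singleton.union (isClosed_pathSupport _)).union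
      (isClosed_singleton.union (isClosed_pathSupport _)))
    (isClosed_eta hT e) (isClosed_eta hT e') (eta_inter_eta_subset hT he hne)
    (disjoint_eta_inside hT h') (disjoint_eta_inside hT h)
  rcases hsub ⟨mem_inside_of_mem_icicle hT hp.1 hps, mem_inside_of_mem_icicle hT hp.2 hps⟩ with
    (hb | hb) | (hb | hb)
  · exact hps (Or.inl hb)
  · exact hps (pathSupport_subset_skeleton _ hb)
  · exact hps (Or.inl hb)
  · exact hps (pathSupport_subset_skeleton _ hb)

end VanKampenDiagram

theorem mainTheorem5 {A : Type*} [Finite A] (R : Set (List (A × Bool))) (hR : R.Finite)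
    (hA : ∀ a : A, wordVal R [(a, true)] ≠ 1)
    (Δ : VanKampenDiagram R) (T : Set Δ.Edge) (hT : IsSpanningTree Δ.carrier T)
    (e e' : Δ.Edge) (he : e ∉ T) (he' : e' ∉ T) :
    (Δ.edgeSet e' ⊆ VanKampenDiagram.icicle hT e →
      VanKampenDiagram.icicle hT e' ⊆ VanKampenDiagram.icicle hT e) ∧
    (¬ Δ.edgeSet e' ⊆ VanKampenDiagram.icicle hT e →
      ¬ Δ.edgeSet e ⊆ VanKampenDiagram.icicle hT e' →
      interior (VanKampenDiagram.icicle hT e) ∩ interior (VanKampenDiagram.icicle hT e') = ∅) :=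
  ⟨VanKampenDiagram.icicle_subset_icicle hT he',
    VanKampenDiagram.interior_icicle_inter_interior_icicle hT he⟩
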